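/- For $\alpha\ge 0$ and $p\in[0,1]$ let $\mathrm{G_{Poi}}(\alpha,p)$ be the random graph obtained as follows: let $N$ have the Poisson law of expectation $\alpha$; given $N$, the vertex set consists of $N$ vertices forming the core and of an infinite set of further vertices, the stack; each pair of distinct vertices at least one of which lies in the core is an edge with probability $p$, independently of all other pairs, and there is no edge between two vertices of the stack. In particular, given $N$, the core is an Erdős–Rényi graph $G(N,p)$, in which each of the $\binom N2$ possible edges is present independently with probability $p$. Write $X_n=o_{\mathbb P}(n)$ if $X_n/n\to 0$ in probability. Fix $c>0$. For each $n$, let $H_n$ be either the core of $\mathrm{G_{Poi}}(n,\frac cn)$ or the fixed-size Erdős–Rényi graph $G(n,\frac cn)$ (with $\frac cn$ replaced by $1$ when $n<c$). In both models the following holds as $n\to\infty$. (i) If $c<1$, then all connected components of $H_n$ have size $o_{\mathbb P}(n)$, i.e. the size of the largest component is $o_{\mathbb P}(n)$. (ii) If $c>1$, then the equation $1-e^{-ct}-t=0$ has exactly one positive root $\beta(c)$, and $H_n$ contains a unique giant component: for every $0<\delta<\beta(c)$, with probability tending to $1$ exactly one component of $H_n$ has at least $\delta n$ vertices. The size of the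 largest component is $\beta(c)n+o_{\mathbb P}(n)$, and all other components have size $o_{\mathbb P}(n)$, i.e. the size of the second largest component is $o_{\mathbb P}(n)$. -/

import Mathlib

open MeasureTheory ProbabilityTheory Filter Topology
open scoped NNReal ENNReal unitInterval

noncomputable section

/-! ### Random graphs -/

/-- Sample space of `G_Poi`: a core with vertex set `Fin N`, for a random `N`, and a stack with
vertex set `ℕ`; the vertex set of the whole graph is `Fin N ⊕ ℕ`. -/
abbrev PoiGraph : Type := Σ N : ℕ, SimpleGraph (Fin N ⊕ ℕ)

/-- The pairs of vertices that may be edges: two distinct vertices, at least one of them in the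
core. In particular there is no edge between two vertices of the stack. -/
def admissibleEdges (N : ℕ) : Set (Sym2 (Fin N ⊕ ℕ)) :=
  {e | ¬ e.IsDiag ∧ ∃ v : Fin N, Sum.inl v ∈ e}

/-- Given the size `N` of the core, every admissible edge is present with probability `p`,
independently of the others. -/
def gPoiGiven (p : I) (N : ℕ) : Measure PoiGraph :=
  (setBernoulli (admissibleEdges N) p).map fun E => ⟨N, SimpleGraph.fromEdgeSet E⟩

/-- The law of `G_Poi(α, p)`: the size `N` of the core has the Poisson law of expectation `α`. -/
def gPoi (α : ℝ≥0) (p : I) : Measure PoiGraph :=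
  (poissonMeasure α).bind (gPoiGiven p)

/-- The core: the subgraph induced on the `N` vertices that are not in the stack. -/
def PoiGraph.core (ω : PoiGraph) : SimpleGraph (Fin ω.1) :=
  ω.2.comap Sum.inl

/-- The edge probability `c / n` (truncated at `1`, which matters only for `n < c`). -/
def edgeProb (c : ℝ) (n : ℕ) : I :=
  Set.projIcc 0 1 zero_le_one (c / n)

lemma measurable_gPoiGiven_aux (N : ℕ) :
    Measurable fun E : Set (Sym2 (Fin N ⊕ ℕ)) =>
      (⟨N, SimpleGraph.fromEdgeSet E⟩ : PoiGraph) :=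
  Measurable.comp (g := fun H : SimpleGraph (Fin N ⊕ ℕ) => (⟨N, H⟩ : PoiGraph))
    (Measurable.of_le_map (iInf_le _ N)) SimpleGraph.measurable_fromEdgeSet

instance (p : I) (N : ℕ) : IsProbabilityMeasure (gPoiGiven p N) :=
  Measure.isProbabilityMeasure_map (measurable_gPoiGiven_aux N).aemeasurable

instance (α : ℝ≥0) (p : I) : IsProbabilityMeasure (gPoi α p) :=
  isProbabilityMeasure_bind (Measurable.of_discrete).aemeasurable
    (Eventually.of_forall fun _ => inferInstance)

/-! ### Sizes of connected components -/

/-- The number of vertices of a connected component. -/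
def compSize {V : Type*} {G : SimpleGraph V} (C : G.ConnectedComponent) : ℕ :=
  C.supp.ncard

/-- The size of a largest connected component of a finite graph (`0` if there are no vertices). -/
def largestComp {V : Type*} (G : SimpleGraph V) : ℕ :=
  sSup {m | ∃ C : G.ConnectedComponent, compSize C = m}

/-- The size of a second largest connected component of a finite graph, i.e. the largest size of a
component other than some fixed component of maximal size (so it equals `largestComp G` if there
are two components of maximal size, and `0` if there is at most one component). -/
def secondComp {V : Type*} (G : SimpleGraph V) : ℕ :=
  sSup {m | ∃ C C' : G.ConnectedComponent, C' ≠ C ∧ compSize C' ≤ compSize C ∧ compSize C' = m}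

/-! ### Asymptotics in probability

The `n`-th random variable lives on a probability space `(Ω n, μ n)`, and so does the `n`-th
random graph `G n`; its vertex set may be random as well. -/

/-- `X n = o_P(n)`: `X n / n` tends to `0` in probability. -/
def LittleOP {Ω : ℕ → Type*} [∀ n, MeasurableSpace (Ω n)] (μ : ∀ n, Measure (Ω n))
    (X : ∀ n, Ω n → ℝ) : Prop :=
  ∀ ε : ℝ, 0 < ε → Tendsto (fun n : ℕ => μ n {ω | ε ≤ |X n ω / n|}) atTop (𝓝 0)

/-- All connected components have size `o_P(n)`. -/
def AllCompsLittleOP {Ω : ℕ → Type*} [∀ n, MeasurableSpace (Ω n)] (μ : ∀ n, Measure (Ω n))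
    {V : ∀ n, Ω n → Type*} (G : ∀ n (ω : Ω n), SimpleGraph (V n ω)) : Prop :=
  LittleOP μ fun n ω => (largestComp (G n ω) : ℝ)

/-- There is a unique giant component, of size `b * n + o_P(n)`, and all other connected
components have size `o_P(n)`. Uniqueness: for every `0 < δ < b`, with probability tending to `1`
exactly one component has at least `δ * n` vertices. -/
def UniqueGiant {Ω : ℕ → Type*} [∀ n, MeasurableSpace (Ω n)] (μ : ∀ n, Measure (Ω n))
    {V : ∀ n, Ω n → Type*} (G : ∀ n (ω : Ω n), SimpleGraph (V n ω)) (b : ℝ) : Prop :=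
  (∀ δ : ℝ, 0 < δ → δ < b →
    Tendsto (fun n : ℕ =>
      μ n {ω | ∃! C : (G n ω).ConnectedComponent, δ * n ≤ (compSize C : ℝ)}) atTop (𝓝 1)) ∧
  LittleOP μ (fun n ω => (largestComp (G n ω) : ℝ) - b * n) ∧
  LittleOP μ (fun n ω => (secondComp (G n ω) : ℝ))

/-- The positive solutions `t` of `1 - exp (-c t) - t = 0`. -/
def positiveRoots (c : ℝ) : Set ℝ :=
  {t | 0 < t ∧ 1 - Real.exp (-(c * t)) - t = 0}

/-- `β(c)`, the first positive root of `1 - exp (-c t) - t = 0`. -/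
def giantFraction (c : ℝ) : ℝ :=
  sInf (positiveRoots c)

end

/-! Explore the graph from a set of `w` seeds among `N` vertices. The probability that the reached
set is a given set of size `s` is at most `(1 - q) ^ (s - w) * q ^ (N - s)` with `q = (1 - p) ^ s`
(`measureReal_reachedExactly_le`). Hence the probability of reaching `s` vertices is at most a
binomial point probability with parameters `N - w` and `1 - q`, exponentially small unless `s` is
close to `N (1 - q) + w q`. For `p = c / n`, `N ≈ n` and `t = s / n` this asks that `excess c t + (w
/ n) exp (-c t)` nearly vanish. Well inside `(0, b)`, with `b` the root, the excess is positive and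
seeds only add to it, so no such size is plausible for any `w`; well beyond `b` none is plausible
for `w ≤ 2`.

A union bound over the polynomially many sets of `seedSets` gives `Typical`, and the rest is
deterministic. By single seeds every component is small or close to `b n`; by pairs two giants
cannot coexist; along initial segments the reached count must jump over the forbidden range, and the
vertex causing the jump lies in a giant (`exists_giant`). For `c < 1` one takes `b = 0` and keeps
the upper bound. In the Poisson model one conditions on `N`, which concentrates near `n`. -/

/-! ### Independent edges and cuts -/

/-- The events `X e`, for `e` a pair of vertices, are independent, and those with `e` not on the
diagonal have probability `p`. -/
structure IndepEdges {Ω V : Type*} [MeasurableSpace Ω] (μ : Measure Ω) (X : Sym2 V → Ω → Prop)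
    (p : ℝ) : Prop where
  measurable : ∀ e, Measurable (X e)
  indep : iIndepFun X μ
  prob : ∀ e, ¬ e.IsDiag → μ.real {ω | X e ω} = p

/-- No pair in `E` joins `S` to `U \ S`, and `E` has a pair across every cut of `S` that separates
the seeds `W` from some other vertex: within `U`, exactly the vertices of `S` are reached
from `W`. -/
def ReachedExactly {V : Type*} (E : Sym2 V → Prop) (U W S : Finset V) : Prop :=
  (∀ a ∈ S, ∀ b ∈ U, b ∉ S → ¬ E s(a, b)) ∧
    ∀ T : Finset V, W ⊆ T → T ⊂ S → ∃ a ∈ T, ∃ b ∈ S, b ∉ T ∧ E s(a, b)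

namespace ReachedExactly

variable {V : Type*} {E E' : Sym2 V → Prop} {U W S : Finset V} {w : V}

/-- Only pairs inside `U` matter; this yields independence from the pairs at a removed vertex. -/
lemma congr (hSU : S ⊆ U) (h : ∀ a ∈ U, ∀ b ∈ U, (E s(a, b) ↔ E' s(a, b)))
    (hE : ReachedExactly E U W S) : ReachedExactly E' U W S := by
  refine ⟨fun a ha b hb hbS he => hE.1 a ha b hb hbS ((h a (hSU ha) b hb).2 he),
    fun T hWT hTS => ?_⟩
  obtain ⟨a, ha, b, hb, hbT, he⟩ := hE.2 T hWT hTS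
  exact ⟨a, ha, b, hb, hbT, (h a (hSU (hTS.1 ha)) b (hSU hb)).1 he⟩

variable [DecidableEq V]

/-- Removing the seed `w`, its neighbours become seeds. -/
lemma erase_seed (hSU : S ⊆ U) (hWS : W ⊆ S) (hw : w ∈ W) (hE : ReachedExactly E U W S) :
    ∃ J ⊆ S \ W, (∀ b ∈ U \ W, (E s(w, b) ↔ b ∈ J)) ∧
      ReachedExactly E (U.erase w) (W.erase w ∪ J) (S.erase w) := by
  classical
  refine ⟨(U \ W).filter fun b => E s(w, b), fun b hb => ?_, fun b hb => by grind, ?_, ?_⟩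
  · simp only [Finset.mem_filter, Finset.mem_sdiff] at hb ⊢
    refine ⟨?_, hb.1.2⟩
    by_contra hbS
    exact hE.1 w (hWS hw) b hb.1.1 hbS hb.2
  · intro a ha b hb hbS
    refine hE.1 a (Finset.mem_of_mem_erase ha) b (Finset.mem_of_mem_erase hb) fun h => hbS ?_
    exact Finset.mem_erase.2 ⟨(Finset.mem_erase.1 hb).1, h⟩
  · intro T hT hTS
    have hwT : w ∉ T := fun h => by simpa using hTS.1 h
    obtain ⟨a, ha, b, hb, hbT, he⟩ := hE.2 (insert w T) (by grind) (by
      refine ⟨by grind, fun h => hTS.2 fun x hx => ?_⟩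
      have := h (Finset.mem_of_mem_erase hx)
      grind)
    -- A neighbour of `w` in `S` lies in `W` or in `J`, hence already in `insert w T`.
    have haw : a ≠ w := by
      rintro rfl
      exact hbT (by grind)
    exact ⟨a, by grind, b, by grind, by grind, he⟩

end ReachedExactly

namespace IndepEdges

variable {Ω V : Type*} [MeasurableSpace Ω] {μ : Measure Ω} [IsProbabilityMeasure μ]
  {X : Sym2 V → Ω → Prop} {p : ℝ}

lemma measureReal_iff (hX : IndepEdges μ X p) {e : Sym2 V} (he : ¬ e.IsDiag) (P : Prop)
    [Decidable P] : μ.real {ω | X e ω ↔ P} = if P then p else 1 - p := by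
  split_ifs with hP
  · simpa [hP] using hX.prob e he
  · have := probReal_compl_eq_one_sub (μ := μ) (s := {ω | X e ω}) (hX.measurable e).setOf
    rw [hX.prob e he] at this
    simpa [hP, Set.compl_ofPred] using this

variable [DecidableEq V]

/-- The law of the neighbourhood of a vertex. -/
lemma measureReal_neighbors (hX : IndepEdges μ X p) {w : V} {A J : Finset V} (hw : w ∉ A)
    (hJ : J ⊆ A) :
    μ.real {ω | ∀ b ∈ A, (X s(w, b) ω ↔ b ∈ J)} = p ^ J.card * (1 - p) ^ (A.card - J.card) := by
  have hinj : Function.Injective fun b : V => s(w, b) := fun a b h => Sym2.congr_right.1 h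
  have h := (hX.indep.precomp hinj).measure_inter_preimage_eq_mul A
    (sets := fun b => {P | P ↔ b ∈ J}) (fun _ _ => MeasurableSet.of_discrete)
  have hset : {ω | ∀ b ∈ A, (X s(w, b) ω ↔ b ∈ J)} =
      ⋂ b ∈ A, X s(w, b) ⁻¹' {P | P ↔ b ∈ J} := by
    ext ω; simp
  rw [hset, measureReal_def, h, ENNReal.toReal_prod]
  have : ∀ b ∈ A, (μ (X s(w, b) ⁻¹' {P | P ↔ b ∈ J})).toReal = if b ∈ J then p else 1 - p := by
    intro b hb
    exact hX.measureReal_iff (e := s(w, b)) (by simp; rintro rfl; exact hw hb) (b ∈ J)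
  rw [Finset.prod_congr rfl this, Finset.prod_ite, Finset.prod_const, Finset.prod_const,
    Finset.filter_mem_eq_inter, Finset.inter_eq_right.2 hJ, Finset.filter_notMem_eq_sdiff,
    Finset.card_sdiff_of_subset hJ]

/-- The neighbourhood of a removed seed is independent of what happens among the other vertices. -/
lemma measureReal_neighbors_inter (hX : IndepEdges μ X p) {w : V} {A J U W S : Finset V}
    (hU : w ∉ U) (hw : w ∉ A) (hJ : J ⊆ A) (hSU : S ⊆ U) :
    μ.real {ω | (∀ b ∈ A, (X s(w, b) ω ↔ b ∈ J)) ∧ ReachedExactly (X · ω) U W S} =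
      p ^ J.card * (1 - p) ^ (A.card - J.card) *
        μ.real {ω | ReachedExactly (X · ω) U W S} := by
  rw [← hX.measureReal_neighbors hw hJ]
  -- The two events depend on pairs at `w` and on pairs inside `U`, which are disjoint families
  -- because `w ∉ U`.
  set F₁ : Finset (Sym2 V) := A.image fun b => s(w, b)
  set F₂ : Finset (Sym2 V) := U.sym2
  have hdisj : Disjoint F₁ F₂ := by
    rw [Finset.disjoint_left]
    intro e he he'
    obtain ⟨b, hb, rfl⟩ := Finset.mem_image.1 he
    exact hU (Finset.mk_mem_sym2_iff.1 he').1
  have hind := hX.indep.indepFun_finset F₁ F₂ hdisj hX.measurable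
  have h₁ : ∀ b ∈ A, s(w, b) ∈ F₁ := fun b hb => Finset.mem_image_of_mem _ hb
  have h₂ : ∀ a ∈ U, ∀ b ∈ U, s(a, b) ∈ F₂ := fun a ha b hb => Finset.mk_mem_sym2_iff.2 ⟨ha, hb⟩
  have := hind.measure_inter_preimage_eq_mul
    {x | ∀ b (hb : b ∈ A), (x ⟨s(w, b), h₁ b hb⟩ ↔ b ∈ J)}
    {x | ReachedExactly (fun e => ∃ h : e ∈ F₂, x ⟨e, h⟩) U W S}
    MeasurableSet.of_discrete MeasurableSet.of_discrete
  have hA : {ω | ReachedExactly (X · ω) U W S} = (fun ω (i : F₂) => X i ω) ⁻¹'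
      {x | ReachedExactly (fun e => ∃ h : e ∈ F₂, x ⟨e, h⟩) U W S} := by
    ext ω
    simp only [Set.mem_ofPred_eq, Set.mem_preimage]
    constructor
    · exact ReachedExactly.congr hSU fun a ha b hb => by simp [h₂ a ha b hb]
    · exact ReachedExactly.congr hSU fun a ha b hb => by simp [h₂ a ha b hb]
  have hB : {ω | ∀ b ∈ A, (X s(w, b) ω ↔ b ∈ J)} = (fun ω (i : F₁) => X i ω) ⁻¹'
      {x | ∀ b (hb : b ∈ A), (x ⟨s(w, b), h₁ b hb⟩ ↔ b ∈ J)} := rfl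
  rw [Set.ofPred_and, hA, hB, measureReal_def, this, ENNReal.toReal_mul]
  rfl

/-- The probability that, within `U`, exactly the vertices of `S` are reached from `W`. -/
theorem measureReal_reachedExactly_le (hX : IndepEdges μ X p) (hp₀ : 0 ≤ p) (hp₁ : p ≤ 1)
    {U W S : Finset V} (hWS : W ⊆ S) (hSU : S ⊆ U) :
    μ.real {ω | ReachedExactly (X · ω) U W S} ≤
      (1 - (1 - p) ^ S.card) ^ (S.card - W.card) *
        (1 - p) ^ (S.card * (U.card - S.card)) := by
  have hq₀ : 0 ≤ 1 - p := by linarith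
  have hq₁ : 1 - p ≤ 1 := by linarith
  induction hs : S.card generalizing U W S with
  | zero =>
    obtain rfl := Finset.card_eq_zero.1 hs
    obtain rfl := Finset.subset_empty.1 hWS
    simp
  | succ s ih =>
    have hx : 0 ≤ 1 - (1 - p) ^ (s + 1) := by linarith [pow_le_one₀ hq₀ hq₁ (n := s + 1)]
    -- Without seeds the cut `T = ∅` of the nonempty `S` can have no edge.
    obtain rfl | ⟨w, hw⟩ := W.eq_empty_or_nonempty
    · have : {ω | ReachedExactly (X · ω) U ∅ S} = ∅ := by
        ext ω
        simp only [Set.mem_ofPred_eq, Set.mem_empty_iff_false, iff_false]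
        intro h
        obtain ⟨a, ha, -⟩ := h.2 ∅ subset_rfl
          (Finset.empty_ssubset.2 (Finset.card_pos.1 (by lia)))
        simp at ha
      rw [this, measureReal_empty]
      positivity
    have hsub : {ω | ReachedExactly (X · ω) U W S} ⊆ ⋃ J ∈ (S \ W).powerset,
        {ω | (∀ b ∈ U \ W, (X s(w, b) ω ↔ b ∈ J)) ∧
          ReachedExactly (X · ω) (U.erase w) (W.erase w ∪ J) (S.erase w)} := by
      intro ω hω
      have hω' : ReachedExactly (X · ω) U W S := hω
      obtain ⟨J, hJ, h⟩ := hω'.erase_seed hSU hWS hw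
      simp only [Set.mem_iUnion]
      exact ⟨J, Finset.mem_powerset.2 hJ, h⟩
    have hwS := hWS hw
    have hcS : (S.erase w).card = s := by rw [Finset.card_erase_of_mem hwS, hs]; rfl
    have hcU : (U.erase w).card = U.card - 1 := Finset.card_erase_of_mem (hSU hwS)
    have hcSW : (S \ W).card = s + 1 - W.card := by rw [Finset.card_sdiff_of_subset hWS, hs]
    have hcUW : (U \ W).card = U.card - W.card := Finset.card_sdiff_of_subset (hWS.trans hSU)
    have hWs : W.card ≤ s + 1 := hs ▸ Finset.card_le_card hWS
    have hsU : s + 1 ≤ U.card := hs ▸ Finset.card_le_card hSU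
    have hW0 : 0 < W.card := Finset.card_pos.2 ⟨w, hw⟩
    calc μ.real {ω | ReachedExactly (X · ω) U W S}
        ≤ ∑ J ∈ (S \ W).powerset, μ.real {ω | (∀ b ∈ U \ W, (X s(w, b) ω ↔ b ∈ J)) ∧
          ReachedExactly (X · ω) (U.erase w) (W.erase w ∪ J) (S.erase w)} :=
          (measureReal_mono hsub (measure_ne_top _ _)).trans (measureReal_biUnion_finset_le _ _)
      _ ≤ ∑ J ∈ (S \ W).powerset, (1 - p) ^ ((s + 1) * (U.card - (s + 1))) *
          (p ^ J.card * ((1 - p) * (1 - (1 - p) ^ s)) ^ ((S \ W).card - J.card)) := by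
          refine Finset.sum_le_sum fun J hJ => ?_
          have hJ' := Finset.mem_powerset.1 hJ
          have hJc := Finset.card_le_card hJ'
          rw [hX.measureReal_neighbors_inter (by simp) (by simp [hw])
            (hJ'.trans (Finset.sdiff_subset_sdiff hSU subset_rfl))
            (Finset.erase_subset_erase _ hSU)]
          have hc : (W.erase w ∪ J).card = W.card - 1 + J.card := by
            rw [Finset.card_union_of_disjoint, Finset.card_erase_of_mem hw]
            rw [Finset.disjoint_left]
            intro a ha haJ
            exact (Finset.mem_sdiff.1 (hJ' haJ)).2 (Finset.mem_of_mem_erase ha)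
          have h := ih (U := U.erase w) (W := W.erase w ∪ J) (S := S.erase w) (by grind)
            (Finset.erase_subset_erase _ hSU) hcS
          rw [hc, hcU] at h
          refine (mul_le_mul_of_nonneg_left h (by positivity)).trans (le_of_eq ?_)
          rw [hcSW, hcUW, mul_pow]
          rw [hcSW] at hJc
          -- The non-neighbours of `w` split into those outside `S`, which raise the exponent from
          -- `s` to `s + 1` per outside vertex, and those in `S`, which stay with the sum over `J`.
          have e1 : U.card - W.card - J.card =
            (U.card - (s + 1)) + (s + 1 - W.card - J.card) := by lia
          have e2 : s - (W.card - 1 + J.card) = s + 1 - W.card - J.card := by lia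
          have e3 : U.card - 1 - s = U.card - (s + 1) := by lia
          rw [e1, e2, e3]
          ring
      _ = _ := by
          -- The binomial theorem, with `p + (1 - p) (1 - (1 - p) ^ s) = 1 - (1 - p) ^ (s + 1)`.
          rw [← Finset.mul_sum, Finset.sum_pow_mul_eq_add_pow, hcSW, mul_comm]
          congr 2
          ring

end IndepEdges

/-! ### The set reached from given seeds -/

/-- The vertices in the connected components of the vertices in `W`. -/
noncomputable def reachSet {V : Type*} [Fintype V] (G : SimpleGraph V) (W : Finset V) : Finset V :=
  open Classical in Finset.univ.filter fun v => ∃ w ∈ W, G.Reachable w v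

section ReachSet

variable {V : Type*} [Fintype V] {G : SimpleGraph V} {W W' : Finset V} {v : V}

@[simp] lemma mem_reachSet : v ∈ reachSet G W ↔ ∃ w ∈ W, G.Reachable w v := by
  simp [reachSet]

lemma subset_reachSet : W ⊆ reachSet G W := fun w hw => mem_reachSet.2 ⟨w, hw, .rfl⟩

/-- The reached set is closed under adjacency, and a walk from a seed to a vertex outside `T` must
leave `T`. -/
lemma reachedExactly_reachSet {E : Sym2 V → Prop} (hG : ∀ a b, a ≠ b → (G.Adj a b ↔ E s(a, b)))
    (W : Finset V) : ReachedExactly E Finset.univ W (reachSet G W) := by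
  have step : ∀ {a b}, a ∈ reachSet G W → G.Adj a b → b ∈ reachSet G W := by
    intro a b ha hab
    obtain ⟨w, hw, h⟩ := mem_reachSet.1 ha
    exact mem_reachSet.2 ⟨w, hw, h.trans hab.reachable⟩
  refine ⟨fun a ha b _ hb he => ?_, fun T hWT hT => ?_⟩
  · have hab : a ≠ b := by rintro rfl; exact hb ha
    exact hb (step ha ((hG a b hab).2 he))
  · obtain ⟨v, hv, hvT⟩ := Finset.exists_of_ssubset hT
    obtain ⟨w, hw, ⟨walk⟩⟩ := mem_reachSet.1 hv
    obtain ⟨d, -, h₁, h₂⟩ := walk.exists_boundary_dart (T : Set V) (hWT hw) hvT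
    exact ⟨d.fst, h₁, d.snd, step (hT.1 h₁) d.adj, h₂, (hG _ _ d.adj.ne).1 d.adj⟩

end ReachSet

/-! ### Large deviations of the number of reached vertices -/

/-- A Chernoff bound for the point probabilities of the binomial law. -/
lemma binomial_le_exp {m k : ℕ} (hk : k ≤ m) {x : ℝ} (hx₀ : 0 ≤ x) (hx₁ : x ≤ 1) {l : ℝ}
    (hl₀ : 0 ≤ l) (hl₁ : l ≤ 1) {d : ℝ} (hd : d ≤ |(k : ℝ) - m * x|) :
    (m.choose k : ℝ) * x ^ k * (1 - x) ^ (m - k) ≤ Real.exp (-(l * d) + m * l ^ 2) := by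
  have key : ∀ θ : ℝ, |θ| ≤ 1 → (m.choose k : ℝ) * x ^ k * (1 - x) ^ (m - k) ≤
      Real.exp (-(θ * (k - m * x)) + m * θ ^ 2) := by
    intro θ hθ
    have h₁ : Real.exp θ ≤ 1 + θ + θ ^ 2 := by
      have := (abs_le.1 (Real.abs_exp_sub_one_sub_id_le hθ)).2
      linarith
    have h₂ : x * Real.exp θ + (1 - x) ≤ Real.exp (x * θ + θ ^ 2) := by
      have := Real.add_one_le_exp (x * θ + θ ^ 2)
      nlinarith [mul_le_mul_of_nonneg_left h₁ hx₀, mul_le_mul_of_nonneg_right hx₁ (sq_nonneg θ)]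
    have hy : 0 ≤ 1 - x := by linarith
    -- The tilted point probability is one term of the binomial expansion of the moment generating
    -- function.
    have h₃ : (x * Real.exp θ) ^ k * (1 - x) ^ (m - k) * m.choose k ≤
        (x * Real.exp θ + (1 - x)) ^ m := by
      rw [add_pow]
      exact Finset.single_le_sum
        (f := fun i => (x * Real.exp θ) ^ i * (1 - x) ^ (m - i) * (m.choose i : ℝ))
        (fun i _ => by positivity) (Finset.mem_range.2 (Nat.lt_succ_of_le hk))
    have h₄ : (x * Real.exp θ + (1 - x)) ^ m ≤ Real.exp (m * (x * θ + θ ^ 2)) := by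
      rw [Real.exp_nat_mul]
      exact pow_le_pow_left₀ (by positivity) h₂ m
    have h₅ : Real.exp θ ^ k * Real.exp (-(θ * k)) = 1 := by
      rw [← Real.exp_nat_mul, ← Real.exp_add]; simp [mul_comm]
    calc (m.choose k : ℝ) * x ^ k * (1 - x) ^ (m - k)
        = (x * Real.exp θ) ^ k * (1 - x) ^ (m - k) * m.choose k * Real.exp (-(θ * k)) := by
          rw [mul_pow]
          linear_combination (-(m.choose k : ℝ) * x ^ k * (1 - x) ^ (m - k)) * h₅
      _ ≤ Real.exp (m * (x * θ + θ ^ 2)) * Real.exp (-(θ * k)) :=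
          mul_le_mul_of_nonneg_right (h₃.trans h₄) (Real.exp_pos _).le
      _ = _ := by rw [← Real.exp_add]; congr 1; ring
  rcases abs_cases ((k : ℝ) - m * x) with ⟨h, -⟩ | ⟨h, -⟩
  · refine (key l (by rwa [abs_of_nonneg hl₀])).trans (Real.exp_le_exp.2 ?_)
    nlinarith
  · refine (key (-l) (by rwa [abs_neg, abs_of_nonneg hl₀])).trans (Real.exp_le_exp.2 ?_)
    nlinarith

namespace IndepEdges

variable {Ω V : Type*} [MeasurableSpace Ω] {μ : Measure Ω} [IsProbabilityMeasure μ]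
  {X : Sym2 V → Ω → Prop} {p : ℝ} [Fintype V] {G : Ω → SimpleGraph V}

/-- A union bound over the possible reached sets `W ∪ K`, whose individual bound depends only on
their size. The unsimplified `1 - (1 - ...)` matches `binomial_le_exp`. -/
theorem measureReal_card_reachSet_le (hX : IndepEdges μ X p) (hp₀ : 0 ≤ p) (hp₁ : p ≤ 1)
    (hG : ∀ ω a b, a ≠ b → ((G ω).Adj a b ↔ X s(a, b) ω)) (W : Finset V) (s : ℕ)
    (hs : W.card ≤ s) :
    μ.real {ω | (reachSet (G ω) W).card = s} ≤
      ((Fintype.card V - W.card).choose (s - W.card) : ℝ) *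
        (1 - (1 - p) ^ s) ^ (s - W.card) * (1 - (1 - (1 - p) ^ s)) ^
          (Fintype.card V - W.card - (s - W.card)) := by
  classical
  have hsub : {ω | (reachSet (G ω) W).card = s} ⊆
      ⋃ K ∈ Finset.powersetCard (s - W.card) (Finset.univ \ W),
        {ω | ReachedExactly (X · ω) Finset.univ W (W ∪ K)} := by
    intro ω hω
    have hω' : (reachSet (G ω) W).card = s := hω
    simp only [Set.mem_iUnion]
    refine ⟨reachSet (G ω) W \ W, ?_, ?_⟩
    · rw [Finset.mem_powersetCard, Finset.card_sdiff_of_subset subset_reachSet, hω']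
      exact ⟨Finset.sdiff_subset_sdiff (Finset.subset_univ _) subset_rfl, rfl⟩
    · rw [Finset.union_sdiff_of_subset subset_reachSet]
      have h := reachedExactly_reachSet (G := G ω) (E := (X · ω)) (hG ω) W
      exact h
  refine (measureReal_mono hsub (measure_ne_top _ _)).trans
    ((measureReal_biUnion_finset_le _ _).trans ?_)
  have hterm : ∀ K ∈ Finset.powersetCard (s - W.card) (Finset.univ \ W),
      μ.real {ω | ReachedExactly (X · ω) Finset.univ W (W ∪ K)} ≤
        (1 - (1 - p) ^ s) ^ (s - W.card) * (1 - (1 - (1 - p) ^ s)) ^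
          (Fintype.card V - W.card - (s - W.card)) := by
    intro K hK
    obtain ⟨hK₁, hK₂⟩ := Finset.mem_powersetCard.1 hK
    have hc : (W ∪ K).card = s := by
      rw [Finset.card_union_of_disjoint, hK₂]
      · lia
      · rw [Finset.disjoint_left]
        exact fun a ha haK => (Finset.mem_sdiff.1 (hK₁ haK)).2 ha
    have h := hX.measureReal_reachedExactly_le hp₀ hp₁ (U := Finset.univ) (W := W) (S := W ∪ K)
      Finset.subset_union_left (Finset.subset_univ _)
    rw [hc, Finset.card_univ] at h
    have e : Fintype.card V - W.card - (s - W.card) = Fintype.card V - s := by lia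
    rwa [e, sub_sub_cancel, ← pow_mul]
  refine (Finset.sum_le_sum hterm).trans (le_of_eq ?_)
  rw [Finset.sum_const, Finset.card_powersetCard, Finset.card_univ_sdiff, nsmul_eq_mul, mul_assoc]

/-- It is exponentially unlikely that the number of reached vertices is `s` when this is not close
to what the exploration predicts. -/
theorem measureReal_card_reachSet_le_exp (hX : IndepEdges μ X p) (hp₀ : 0 ≤ p) (hp₁ : p ≤ 1)
    (hG : ∀ ω a b, a ≠ b → ((G ω).Adj a b ↔ X s(a, b) ω)) (W : Finset V) (s : ℕ)
    {n : ℕ} {η : ℝ} (hη₀ : 0 ≤ η) (hη₁ : η ≤ 4) (hn : Fintype.card V ≤ 2 * n)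
    (hd : η * n ≤ |(s : ℝ) - Fintype.card V * (1 - (1 - p) ^ s) - W.card * (1 - p) ^ s|) :
    μ.real {ω | (reachSet (G ω) W).card = s} ≤ Real.exp (-(η ^ 2 / 8 * n)) := by
  by_cases hs : W.card ≤ s ∧ s ≤ Fintype.card V
  · obtain ⟨hs₁, hs₂⟩ := hs
    have hq₁ : (1 - p) ^ s ≤ 1 := pow_le_one₀ (by linarith) (by linarith)
    have hq₀ : 0 ≤ (1 - p) ^ s := pow_nonneg (by linarith) _
    refine (hX.measureReal_card_reachSet_le hp₀ hp₁ hG W s hs₁).trans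
      ((binomial_le_exp (by lia) (by linarith) (by linarith) (l := η / 4) (by linarith)
        (by linarith) (d := η * n) ?_).trans (Real.exp_le_exp.2 ?_))
    · refine hd.trans (le_of_eq ?_)
      rw [Nat.cast_sub hs₁, Nat.cast_sub (hs₁.trans hs₂)]
      congr 1
      ring
    · rw [Nat.cast_sub (hs₁.trans hs₂)]
      have : (Fintype.card V : ℝ) - W.card ≤ 2 * n := by
        have : (Fintype.card V : ℝ) ≤ 2 * n := by exact_mod_cast hn
        linarith [Nat.cast_nonneg (α := ℝ) W.card]
      nlinarith [mul_le_mul_of_nonneg_right this (sq_nonneg (η / 4))]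
  · have : {ω | (reachSet (G ω) W).card = s} = ∅ := by
      ext ω
      simp only [Set.mem_ofPred_eq, Set.mem_empty_iff_false, iff_false]
      rintro rfl
      exact hs ⟨Finset.card_le_card subset_reachSet, Finset.card_le_univ _⟩
    rw [this, measureReal_empty]
    exact (Real.exp_pos _).le

/-- The union bound over a family of seed sets. -/
theorem measureReal_exists_bad_le {b : ℝ} (𝓕 : Finset (Finset V)) (bad : Finset V → ℕ → Prop)
    (hbad : ∀ W ∈ 𝓕, ∀ s ≤ Fintype.card V, bad W s →
      μ.real {ω | (reachSet (G ω) W).card = s} ≤ b) (hb : 0 ≤ b) :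
    μ.real {ω | ∃ W ∈ 𝓕, bad W (reachSet (G ω) W).card} ≤
      𝓕.card * ((Fintype.card V + 1) * b) := by
  classical
  have hsub : {ω | ∃ W ∈ 𝓕, bad W (reachSet (G ω) W).card} ⊆
      ⋃ W ∈ 𝓕, ⋃ s ∈ Finset.range (Fintype.card V + 1),
        {ω | bad W s ∧ (reachSet (G ω) W).card = s} := by
    rintro ω ⟨W, hW, h⟩
    simp only [Set.mem_iUnion]
    exact ⟨W, hW, _, Finset.mem_range.2 (Nat.lt_succ_of_le (Finset.card_le_univ _)), h, rfl⟩
  refine (measureReal_mono hsub (measure_ne_top _ _)).trans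
    ((measureReal_biUnion_finset_le _ _).trans ?_)
  rw [← nsmul_eq_mul]
  refine Finset.sum_le_card_nsmul _ _ _ fun W hW => (measureReal_biUnion_finset_le _ _).trans ?_
  refine (Finset.sum_le_card_nsmul _ _ b fun s hs => ?_).trans
    (by rw [Finset.card_range, nsmul_eq_mul]; push_cast; rfl)
  by_cases h : bad W s
  · simpa [h] using hbad W hW s (Nat.le_of_lt_succ (Finset.mem_range.1 hs)) h
  · simpa [h] using hb

end IndepEdges

/-! ### The equation `1 - exp (-c t) - t = 0` -/

/-- The function whose positive root is the fraction of vertices in the giant component. -/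
noncomputable def excess (c t : ℝ) : ℝ := 1 - Real.exp (-(c * t)) - t

lemma continuous_excess (c : ℝ) : Continuous (excess c) := by
  unfold excess; fun_prop

lemma excess_le (c t : ℝ) : excess c t ≤ (c - 1) * t := by
  have := Real.add_one_le_exp (-(c * t))
  unfold excess
  linarith

/-- `excess c t / t` is strictly decreasing. -/
lemma mul_excess_lt_mul_excess {c a b : ℝ} (hc : 0 < c) (ha : 0 < a) (hab : a < b) :
    a * excess c b < b * excess c a := by
  -- Strict convexity of `exp` at `-c a`, a point between `-c b` and `0`.
  have hb : 0 < b := ha.trans hab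
  have h := strictConvexOn_exp.2 (Set.mem_univ 0) (Set.mem_univ (-(c * b))) (by nlinarith)
    
    (show 0 < (b - a) / b from div_pos (by linarith) hb) (div_pos ha hb) (by field_simp; ring)
  have e : ((b - a) / b) • (0 : ℝ) + (a / b) • (-(c * b)) = -(c * a) := by
    simp only [smul_eq_mul]; field_simp; ring
  rw [e, Real.exp_zero, smul_eq_mul, smul_eq_mul] at h
  have h' : b * Real.exp (-(c * a)) < (b - a) * 1 + a * Real.exp (-(c * b)) := by
    calc b * Real.exp (-(c * a))
        < b * ((b - a) / b * 1 + a / b * Real.exp (-(c * b))) := by gcongr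
      _ = _ := by field_simp
  unfold excess
  nlinarith

lemma exists_excess_eq_zero {c : ℝ} (hc : 1 < c) : ∃ t, 0 < t ∧ excess c t = 0 := by
  -- For this `a`, `(1 - a) (1 + c a) = (c + 1)² / (4 c) > 1`, so `exp (-c a) ≤ 1 / (1 + c a) < 1 -
  -- a`.
  set a : ℝ := (c - 1) / (2 * c) with ha
  have ha₀ : 0 < a := div_pos (by linarith) (by linarith)
  have ha₁ : a < 1 := by rw [ha, div_lt_one (by linarith)]; linarith
  have hca : c * a = (c - 1) / 2 := by rw [ha]; field_simp
  have hpos : 0 < excess c a := by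
    have h₁ : Real.exp (-(c * a)) ≤ 1 / (1 + c * a) := by
      rw [Real.exp_neg, ← one_div]
      exact one_div_le_one_div_of_le (by nlinarith) (by linarith [Real.add_one_le_exp (c * a)])
    have h₂ : 1 / (1 + c * a) < 1 - a := by
      rw [div_lt_iff₀ (by nlinarith)]
      nlinarith
    unfold excess
    linarith
  have hneg : excess c 1 < 0 := by
    unfold excess
    linarith [Real.exp_pos (-(c * 1))]
  obtain ⟨t, ht, h⟩ := intermediate_value_Icc' ha₁.le (continuous_excess c).continuousOn
    ⟨hneg.le, hpos.le⟩
  exact ⟨t, ha₀.trans_le ht.1, h⟩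

lemma positiveRoots_eq {c : ℝ} (hc : 1 < c) : positiveRoots c = {giantFraction c} := by
  obtain ⟨t, ht, h⟩ := exists_excess_eq_zero hc
  have : positiveRoots c = {t} := by
    ext u
    simp only [positiveRoots, Set.mem_ofPred_eq, Set.mem_singleton_iff]
    refine ⟨fun ⟨hu, hu'⟩ => ?_, fun hu => hu ▸ ⟨ht, h⟩⟩
    have hu'' : excess c u = 0 := hu'
    rcases lt_trichotomy u t with hut | hut | hut
    · have := mul_excess_lt_mul_excess (c := c) (by linarith) hu hut
      simp [h, hu''] at this
    · exact hut
    · have := mul_excess_lt_mul_excess (c := c) (by linarith) ht hut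
      simp [h, hu''] at this
  rw [giantFraction, this, csInf_singleton]

lemma giantFraction_spec {c : ℝ} (hc : 1 < c) :
    0 < giantFraction c ∧ excess c (giantFraction c) = 0 := by
  obtain ⟨t, ht, h⟩ := exists_excess_eq_zero hc
  have : t ∈ positiveRoots c := ⟨ht, h⟩
  rw [positiveRoots_eq hc, Set.mem_singleton_iff] at this
  subst this
  exact ⟨ht, h⟩

/-- `excess c` is bounded away from zero, with the signs `+` and `-`, at distance `δ` from `0` and
from `b` to the left and to the right of `b`. -/
def ExcessGap (c b δ η : ℝ) : Prop :=
  (∀ y, δ ≤ y → y ≤ b - δ → 3 * η ≤ excess c y) ∧ ∀ y, b + δ ≤ y → excess c y ≤ -(4 * η)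

/-- For `b = 0` the first half of the gap is void; the second follows from `excess_le`. -/
lemma exists_excessGap_subcritical {c δ : ℝ} (hc₁ : c < 1) (hδ : 0 < δ) :
    ∃ η > 0, ExcessGap c 0 δ η := by
  refine ⟨(1 - c) * δ / 4, by have := mul_pos (sub_pos.2 hc₁) hδ; positivity,
    fun y h₁ h₂ => by linarith, fun y hy => (excess_le c y).trans ?_⟩
  nlinarith

/-- Below the root the gap comes from compactness; above it, `excess c` is negative and decreasing
because `excess c t / t` decreases. -/
lemma exists_excessGap_supercritical {c δ : ℝ} (hc : 1 < c) (hδ : 0 < δ) :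
    ∃ η > 0, ExcessGap c (giantFraction c) δ η := by
  obtain ⟨hb₀, hb⟩ := giantFraction_spec hc
  set b := giantFraction c
  have hlow : ∃ η > 0, ∀ y, δ ≤ y → y ≤ b - δ → η ≤ excess c y := by
    rcases (Set.Icc δ (b - δ)).eq_empty_or_nonempty with h | h
    · refine ⟨1, one_pos, fun y h₁ h₂ => ?_⟩
      have : y ∈ Set.Icc δ (b - δ) := ⟨h₁, h₂⟩
      simp [h] at this
    · obtain ⟨x, hx, hmin⟩ := isCompact_Icc.exists_isMinOn h (continuous_excess c).continuousOn
      refine ⟨excess c x, ?_, fun y h₁ h₂ => hmin ⟨h₁, h₂⟩⟩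
      have := mul_excess_lt_mul_excess (c := c) (by linarith) (hδ.trans_le hx.1)
        (b := b) (by linarith [hx.2])
      rw [hb, mul_zero] at this
      exact pos_of_mul_pos_right this hb₀.le
  have hhigh : 0 < -excess c (b + δ) := by
    have := mul_excess_lt_mul_excess (c := c) (by linarith) hb₀ (b := b + δ) (by linarith)
    rw [hb, mul_zero] at this
    nlinarith
  obtain ⟨η, hη, h⟩ := hlow
  refine ⟨min (η / 3) (-excess c (b + δ) / 4), by positivity, fun y h₁ h₂ => ?_, fun y hy => ?_⟩
  · linarith [h y h₁ h₂, min_le_left (η / 3) (-excess c (b + δ) / 4)]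
  · have hmin := min_le_right (η / 3) (-excess c (b + δ) / 4)
    have hy' : excess c y ≤ excess c (b + δ) := by
      rcases hy.eq_or_lt with rfl | hy
      · rfl
      · have := mul_excess_lt_mul_excess (c := c) (by linarith) (by linarith) hy
        nlinarith
    linarith

/-- Raise `exp (-x) (1 - x²) ≤ 1 - x ≤ exp (-x)` to the power `s` and use Bernoulli's inequality.
For `x = c / n` and `s ≤ 2 n` the error is at most `2 c² / n`. -/
lemma abs_one_sub_pow_sub_exp_le {x : ℝ} (hx₀ : 0 ≤ x) (hx₁ : x ≤ 1) (s : ℕ) :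
    |(1 - x) ^ s - Real.exp (-(x * s))| ≤ s * x ^ 2 := by
  have he : Real.exp (-(x * s)) = Real.exp (-x) ^ s := by
    rw [← Real.exp_nat_mul]; ring_nf
  have h₀ : 0 ≤ 1 - x := by linarith
  have h₁ : (1 - x) ^ s ≤ Real.exp (-x) ^ s :=
    pow_le_pow_left₀ h₀ (by linarith [Real.add_one_le_exp (-x)]) s
  have h₂ : Real.exp (-x) * (1 - x ^ 2) ≤ 1 - x := by
    have h : Real.exp (-x) * (1 + x) ≤ 1 := by
      calc Real.exp (-x) * (1 + x) ≤ Real.exp (-x) * Real.exp x := by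
            gcongr; linarith [Real.add_one_le_exp x]
        _ = 1 := by rw [← Real.exp_add]; simp
    nlinarith
  have hx₂ : 0 ≤ 1 - x ^ 2 := by nlinarith
  have h₃ : Real.exp (-x) ^ s * (1 - s * x ^ 2) ≤ (1 - x) ^ s := by
    calc Real.exp (-x) ^ s * (1 - s * x ^ 2) ≤ Real.exp (-x) ^ s * (1 - x ^ 2) ^ s := by
          gcongr
          have := one_add_mul_le_pow (a := -x ^ 2) (by nlinarith) s
          rw [← sub_eq_add_neg] at this
          linarith
      _ = (Real.exp (-x) * (1 - x ^ 2)) ^ s := by rw [mul_pow]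
      _ ≤ _ := pow_le_pow_left₀ (by positivity) h₂ s
  have h₄ : Real.exp (-x) ^ s ≤ 1 := pow_le_one₀ (by positivity) (by simpa using hx₀)
  rw [he, abs_le]
  have : Real.exp (-x) ^ s * (s * x ^ 2) ≤ 1 * (s * x ^ 2) := by gcongr
  constructor <;> nlinarith [mul_nonneg (Nat.cast_nonneg (α := ℝ) s) (sq_nonneg x)]

/-! ### Typical graphs -/

/-- The initial segments of `Fin N` and the sets of at most two vertices. -/
def seedSets (N : ℕ) : Finset (Finset (Fin N)) :=
  (Finset.range (N + 1)).image (fun j => Finset.univ.filter fun i : Fin N => (i : ℕ) < j) ∪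
    Finset.univ.image fun v : Fin N × Fin N => {v.1, v.2}

lemma card_seedSets_le (N : ℕ) : (seedSets N).card ≤ N + 1 + N * N := by
  refine (Finset.card_union_le _ _).trans (add_le_add (Finset.card_image_le.trans ?_)
    (Finset.card_image_le.trans ?_)) <;> simp

/-- From no set of seeds in `seedSets N` the number of reached vertices lies strictly between a
small one and `b n`, and from at most two seeds it does not exceed `b n` significantly. -/
def Typical {N : ℕ} (n : ℕ) (b δ : ℝ) (G : SimpleGraph (Fin N)) : Prop :=
  ∀ W ∈ seedSets N, ¬ (δ * n ≤ (reachSet G W).card ∧ ((reachSet G W).card : ℝ) ≤ (b - δ) * n) ∧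
    ¬ (W.card ≤ 2 ∧ (b + δ) * n ≤ (reachSet G W).card)

/-- The deviation that makes the counts excluded in `Typical` unlikely. -/
lemma ExcessGap.le_abs_deviation {c b δ η : ℝ} (h : ExcessGap c b δ η) {n N j s : ℕ} {Q : ℝ} (hn : 0 < n)
    (hN : |(N : ℝ) - n| ≤ η * n) (hQ₀ : 0 ≤ Q) (hQ₁ : Q ≤ 1) (hj : 2 ≤ η * n)
    (hQ : |Q - Real.exp (-(c * (s / n)))| ≤ η)
    (hs : (δ * n ≤ s ∧ (s : ℝ) ≤ (b - δ) * n) ∨ (j ≤ 2 ∧ (b + δ) * n ≤ s)) :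
    η * n ≤ |(s : ℝ) - N * (1 - Q) - j * Q| := by
  have hn' : (0 : ℝ) < n := by exact_mod_cast hn
  obtain ⟨hN₁, hN₂⟩ := abs_le.1 hN
  obtain ⟨hE₁, hE₂⟩ := abs_le.1 hQ
  have hj₀ : (0 : ℝ) ≤ j := Nat.cast_nonneg j
  have hsn : (s / n : ℝ) * n = s := div_mul_cancel₀ _ hn'.ne'
  have hQn : Q * n = Real.exp (-(c * (s / n))) * n + (Q - Real.exp (-(c * (s / n)))) * n := by ring
  have hE₁' := mul_le_mul_of_nonneg_right hE₁ hn'.le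
  have hE₂' := mul_le_mul_of_nonneg_right hE₂ hn'.le
  -- Replacing `N` by `n` and `Q` by the exponential costs `η n` each. Below the root `3 η`
  -- suffices, as `j Q` only helps; above it the fourth `η` pays for `j Q ≤ 2 ≤ η n`.
  rcases hs with ⟨h₁, h₂⟩ | ⟨h₁, h₂⟩
  · have hf := h.1 (s / n) ((le_div_iff₀ hn').2 h₁) ((div_le_iff₀ hn').2 h₂)
    unfold excess at hf
    have hf' := mul_le_mul_of_nonneg_right hf hn'.le
    rw [le_abs]
    right
    nlinarith [mul_nonneg hj₀ hQ₀]
  · have hf := h.2 (s / n) ((le_div_iff₀ hn').2 h₂)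
    unfold excess at hf
    have hf' := mul_le_mul_of_nonneg_right hf hn'.le
    have hj₂ : (j : ℝ) ≤ 2 := by exact_mod_cast h₁
    rw [le_abs]
    left
    nlinarith [mul_le_mul_of_nonneg_left hQ₁ hj₀]

/-- The bound on the probability that the random graph is not typical. -/
noncomputable def atypicalBound (η : ℝ) (n : ℕ) : ℝ :=
  (2 * n + 1 + 2 * n * (2 * n)) * ((2 * n + 1) * Real.exp (-(η ^ 2 / 8 * n)))

lemma tendsto_atypicalBound {η : ℝ} (hη : 0 < η) :
    Tendsto (atypicalBound η) atTop (𝓝 0) := by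
  have h : ∀ k : ℕ, Tendsto (fun n : ℕ => (n : ℝ) ^ k * Real.exp (-(η ^ 2 / 8 * n)))
      atTop (𝓝 0) := fun k => by
    have := (tendsto_rpow_mul_exp_neg_mul_atTop_nhds_zero k (η ^ 2 / 8)
      (by positivity)).comp tendsto_natCast_atTop_atTop
    simpa [Function.comp_def] using this
  have := (((h 3).const_mul 8).add ((h 2).const_mul 8)).add (((h 1).const_mul 4).add (h 0))
  simp only [mul_zero, add_zero] at this
  refine this.congr fun n => ?_
  unfold atypicalBound
  ring

/-- Typicality holds with high probability, uniformly in the number of vertices near `n`. -/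
theorem IndepEdges.measureReal_not_typical_le {Ω : Type*} [MeasurableSpace Ω] {μ : Measure Ω}
    [IsProbabilityMeasure μ] {N n : ℕ} {X : Sym2 (Fin N) → Ω → Prop} {c b δ η : ℝ} (hc : 0 < c)
    (hgap : ExcessGap c b δ η) (hη₀ : 0 < η) (hη₁ : η ≤ 1) (hn : 0 < n) (hcn : c ≤ n)
    (hn₁ : 2 ≤ η * n) (hn₂ : 2 * c ^ 2 ≤ η * n) (hN : |(N : ℝ) - n| ≤ η * n)
    (hX : IndepEdges μ X (c / n)) {G : Ω → SimpleGraph (Fin N)}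
    (hG : ∀ ω a b, a ≠ b → ((G ω).Adj a b ↔ X s(a, b) ω)) :
    μ.real {ω | ¬ Typical n b δ (G ω)} ≤ atypicalBound η n := by
  have hn' : (0 : ℝ) < n := by exact_mod_cast hn
  have hN₂ : (N : ℝ) ≤ 2 * n := by nlinarith [(abs_le.1 hN).2]
  have hN₃ : N ≤ 2 * n := by exact_mod_cast hN₂
  have hp₀ : 0 ≤ c / n := by positivity
  have hp₁ : c / n ≤ 1 := (div_le_one hn').2 hcn
  set bad : Finset (Fin N) → ℕ → Prop := fun W s =>
    (δ * n ≤ s ∧ (s : ℝ) ≤ (b - δ) * n) ∨ (W.card ≤ 2 ∧ (b + δ) * n ≤ s)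
  have hset : {ω | ¬ Typical n b δ (G ω)} =
      {ω | ∃ W ∈ seedSets N, bad W (reachSet (G ω) W).card} := by
    ext ω
    simp only [Typical, Set.mem_ofPred_eq, not_forall, exists_prop, bad]
    refine exists_congr fun W => and_congr_right fun _ => ?_
    tauto
  rw [hset]
  refine (measureReal_exists_bad_le (μ := μ) (G := G) (seedSets N) bad (fun W _ s hs hbad =>
    ?_) (Real.exp_pos (-(η ^ 2 / 8 * n))).le).trans ?_
  · rw [Fintype.card_fin] at hs
    have hs' : (s : ℝ) ≤ 2 * n := (Nat.cast_le.2 hs).trans hN₂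
    refine hX.measureReal_card_reachSet_le_exp hp₀ hp₁ hG W s hη₀.le (by linarith)
      (by simpa using hN₃) ?_
    rw [Fintype.card_fin]
    refine hgap.le_abs_deviation hn hN (pow_nonneg (by linarith) _) (pow_le_one₀ (by linarith) (by linarith))
      hn₁ ?_ hbad
    have h := abs_one_sub_pow_sub_exp_le hp₀ hp₁ s
    rw [div_mul_eq_mul_div, mul_div_assoc] at h
    refine h.trans ?_
    calc (s : ℝ) * (c / n) ^ 2 ≤ 2 * n * (c / n) ^ 2 := by gcongr
      _ = 2 * c ^ 2 / n := by field_simp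
      _ ≤ η := (div_le_iff₀ hn').2 hn₂
  · unfold atypicalBound
    rw [Fintype.card_fin]
    have h₁ : ((seedSets N).card : ℝ) ≤ N + 1 + N * N := by exact_mod_cast card_seedSets_le N
    gcongr
    refine h₁.trans ?_
    gcongr

/-! ### Components of typical graphs -/

/-- `0 ≤ B` covers the empty set, whose `sSup` is `0`: no vertices, or no second component. -/
lemma natCast_sSup_le {S : Set ℕ} {B : ℝ} (hB : 0 ≤ B) (h : ∀ m ∈ S, (m : ℝ) ≤ B) :
    ((sSup S : ℕ) : ℝ) ≤ B := by
  rcases S.eq_empty_or_nonempty with rfl | hS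
  · simpa using hB
  · exact h _ (Nat.sSup_mem hS ⟨⌊B⌋₊, fun m hm => Nat.le_floor (h m hm)⟩)

section Components

variable {V : Type*} [Fintype V] {G : SimpleGraph V}

lemma card_reachSet_singleton (v : V) :
    (reachSet G {v}).card = compSize (G.connectedComponentMk v) := by
  rw [compSize, ← Set.ncard_coe_finset]
  congr 1
  ext u
  simp [SimpleGraph.reachable_comm]

lemma card_reachSet_pair [DecidableEq V] {v w : V}
    (h : G.connectedComponentMk v ≠ G.connectedComponentMk w) :
    (reachSet G {v, w}).card =
      compSize (G.connectedComponentMk v) + compSize (G.connectedComponentMk w) := by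
  rw [← card_reachSet_singleton, ← card_reachSet_singleton, ← Finset.card_union_of_disjoint]
  · congr 1
    ext u
    simp
  · rw [Finset.disjoint_left]
    intro u hu hu'
    simp only [mem_reachSet, Finset.mem_singleton, exists_eq_left] at hu hu'
    exact h (SimpleGraph.ConnectedComponent.sound (hu.trans hu'.symm))

lemma compSize_le_largestComp (C : G.ConnectedComponent) : compSize C ≤ largestComp G := by
  refine le_csSup ⟨Fintype.card V, ?_⟩ ⟨C, rfl⟩
  rintro _ ⟨C, rfl⟩
  rw [← Nat.card_eq_fintype_card]
  exact Set.ncard_le_card _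

end Components

namespace Typical

variable {N n : ℕ} {b δ : ℝ} {G : SimpleGraph (Fin N)}

lemma pair_mem_seedSets (v w : Fin N) : {v, w} ∈ seedSets N :=
  Finset.mem_union_right _ (Finset.mem_image.2 ⟨(v, w), Finset.mem_univ _, rfl⟩)

lemma initial_mem_seedSets {j : ℕ} (hj : j ≤ N) :
    (Finset.univ.filter fun i : Fin N => (i : ℕ) < j) ∈ seedSets N :=
  Finset.mem_union_left _ (Finset.mem_image.2 ⟨j, Finset.mem_range.2 (by lia), rfl⟩)

lemma compSize_lt (h : Typical n b δ G) (C : G.ConnectedComponent) :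
    (compSize C : ℝ) < (b + δ) * n := by
  induction C using SimpleGraph.ConnectedComponent.ind with | _ v
  have := (h _ (pair_mem_seedSets v v)).2
  rw [Finset.pair_eq_singleton, card_reachSet_singleton] at this
  by_contra! hC
  exact this ⟨by simp, hC⟩

lemma compSize_lt_or_lt (h : Typical n b δ G) (C : G.ConnectedComponent) :
    (compSize C : ℝ) < δ * n ∨ (b - δ) * n < compSize C := by
  induction C using SimpleGraph.ConnectedComponent.ind with | _ v
  have := (h _ (pair_mem_seedSets v v)).1
  rw [Finset.pair_eq_singleton, card_reachSet_singleton] at this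
  by_contra! hC
  exact this hC

lemma compSize_add_lt (h : Typical n b δ G) {C C' : G.ConnectedComponent} (hC : C ≠ C') :
    (compSize C : ℝ) + compSize C' < (b + δ) * n := by
  induction C using SimpleGraph.ConnectedComponent.ind with | _ v
  induction C' using SimpleGraph.ConnectedComponent.ind with | _ w
  have := (h _ (pair_mem_seedSets v w)).2
  rw [card_reachSet_pair hC] at this
  by_contra! hC
  exact this ⟨Finset.card_le_two, by exact_mod_cast hC⟩

/-- The union of the components of the first `j` vertices jumps at some `j` from less than `δ n` to
more than `(b - δ) n` vertices. -/
lemma exists_giant (h : Typical n b δ G) (hδ : 0 < δ) (hb : 3 * δ ≤ b) (hn : 0 < n)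
    (hN : δ * n ≤ N) : ∃ C : G.ConnectedComponent, (b - δ) * n < compSize C := by
  classical
  have hn' : (0 : ℝ) < n := by exact_mod_cast hn
  set W : ℕ → Finset (Fin N) := fun j => Finset.univ.filter fun i : Fin N => (i : ℕ) < j with hW
  have hex : ∃ j, δ * n ≤ (reachSet G (W j)).card := by
    refine ⟨N, hN.trans ?_⟩
    have : (W N) = Finset.univ := by ext i; simp [hW]
    have h' := Finset.card_le_card (subset_reachSet (G := G) (W := W N))
    rw [this, Finset.card_univ, Fintype.card_fin] at h'
    rw [this]
    exact_mod_cast h'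
  obtain ⟨j, hj, hmin⟩ : ∃ j, δ * n ≤ (reachSet G (W j)).card ∧
      ∀ i < j, (reachSet G (W i)).card < δ * n :=
    ⟨Nat.find hex, Nat.find_spec hex, fun i hi => not_le.1 (Nat.find_min hex hi)⟩
  have hj₀ : j ≠ 0 := by
    rintro rfl
    have : reachSet G (W 0) = ∅ := by ext; simp [hW]
    rw [this] at hj
    simp only [Finset.card_empty, Nat.cast_zero] at hj
    nlinarith
  obtain ⟨i, rfl⟩ := Nat.exists_eq_succ_of_ne_zero hj₀
  have hi := hmin i (Nat.lt_succ_self i)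
  have hiN : i < N := by
    by_contra! hNi
    have : W (i + 1) = W i := by
      ext x
      simp only [hW, Finset.mem_filter, Finset.mem_univ, true_and]
      have := x.2
      lia
    rw [Nat.succ_eq_add_one, this] at hj
    linarith
  have hbig : (b - δ) * n < (reachSet G (W (i + 1))).card := by
    by_contra! hle
    exact (h _ (initial_mem_seedSets hiN)).1 ⟨hj, hle⟩
  have hstep : (reachSet G (W (i + 1))).card ≤
      (reachSet G (W i)).card + (reachSet G {(⟨i, hiN⟩ : Fin N)}).card := by
    refine (Finset.card_le_card fun u hu => ?_).trans (Finset.card_union_le _ _)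
    obtain ⟨w, hw, hwu⟩ := mem_reachSet.1 hu
    simp only [hW, Finset.mem_filter, Finset.mem_univ, true_and] at hw
    simp only [Finset.mem_union, mem_reachSet, Finset.mem_singleton, exists_eq_left]
    rcases Nat.lt_succ_iff_lt_or_eq.1 hw with hw | hw
    · exact Or.inl ⟨w, by simpa [hW] using hw, hwu⟩
    · obtain rfl : w = ⟨i, hiN⟩ := Fin.ext hw
      exact Or.inr hwu
  rw [card_reachSet_singleton] at hstep
  -- The new component has more than `(b - δ) n - δ n ≥ δ n` vertices, so it is not small.
  refine ⟨_, (h.compSize_lt_or_lt (G.connectedComponentMk ⟨i, hiN⟩)).resolve_left ?_⟩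
  have hstep' : ((reachSet G (W (i + 1))).card : ℝ) ≤ (reachSet G (W i)).card +
      compSize (G.connectedComponentMk ⟨i, hiN⟩) := by exact_mod_cast hstep
  nlinarith

lemma largestComp_le (h : Typical n b δ G) (hb : 0 ≤ b + δ) :
    (largestComp G : ℝ) ≤ (b + δ) * n := by
  refine natCast_sSup_le (by positivity) ?_
  rintro _ ⟨C, rfl⟩
  exact (h.compSize_lt C).le

lemma abs_largestComp_sub_le (h : Typical n b δ G) (hδ : 0 < δ) (hb : 3 * δ ≤ b) (hn : 0 < n)
    (hN : δ * n ≤ N) : |(largestComp G : ℝ) - b * n| ≤ δ * n := by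
  obtain ⟨C, hC⟩ := h.exists_giant hδ hb hn hN
  have h₁ : (compSize C : ℝ) ≤ largestComp G := by exact_mod_cast compSize_le_largestComp C
  have h₂ := h.largestComp_le (by linarith)
  rw [abs_le]
  constructor <;> linarith

lemma eq_of_le_compSize (h : Typical n b δ G) (hb : 3 * δ ≤ b)
    {C C' : G.ConnectedComponent} (hC : δ * n ≤ compSize C) (hC' : δ * n ≤ compSize C') :
    C = C' := by
  by_contra hne
  have h₁ := (h.compSize_lt_or_lt C).resolve_left hC.not_gt
  have h₂ := (h.compSize_lt_or_lt C').resolve_left hC'.not_gt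
  have h₃ := h.compSize_add_lt hne
  -- Two giants would total more than `2 (b - δ) n ≥ (b + δ) n`.
  nlinarith [mul_le_mul_of_nonneg_right hb (Nat.cast_nonneg (α := ℝ) n)]

lemma secondComp_le (h : Typical n b δ G) (hδ : 0 < δ) (hb : 3 * δ ≤ b) :
    (secondComp G : ℝ) ≤ δ * n := by
  refine natCast_sSup_le (by positivity) ?_
  rintro _ ⟨C, C', hne, hle, rfl⟩
  by_contra! hC'
  exact hne (h.eq_of_le_compSize hb hC'.le (hC'.le.trans (by exact_mod_cast hle)))

lemma existsUnique_giant (h : Typical n b δ G) (hδ : 0 < δ) (hb : 3 * δ ≤ b) (hn : 0 < n)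
    (hN : δ * n ≤ N) {δ' : ℝ} (hδ' : δ ≤ δ') (hb' : δ' ≤ b - δ) :
    ∃! C : G.ConnectedComponent, δ' * n ≤ compSize C := by
  obtain ⟨C, hC⟩ := h.exists_giant hδ hb hn hN
  have hn' : (0 : ℝ) ≤ n := Nat.cast_nonneg n
  refine ⟨C, (mul_le_mul_of_nonneg_right hb' hn').trans hC.le, fun C' hC' => ?_⟩
  exact h.eq_of_le_compSize hb ((mul_le_mul_of_nonneg_right hδ' hn').trans hC')
    ((mul_le_mul_of_nonneg_right (hδ'.trans hb') hn').trans hC.le)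

end Typical

/-! ### The two models -/

/-- Serves both models: `f` is the identity for the fixed-size graph and `Sym2.map Sum.inl` for the
core. -/
lemma IndepEdges.setBernoulli {ι V : Type*} (u : Set ι) (p : I) (f : Sym2 V → ι)
    (hf : Function.Injective f) (hu : ∀ e, ¬ e.IsDiag → f e ∈ u) :
    IndepEdges (ProbabilityTheory.setBernoulli u p) (fun e (E : Set ι) => f e ∈ E) p := by
  set P : ι → Measure Prop := fun i => unitInterval.toNNReal p • Measure.dirac (i ∈ u) +
    unitInterval.toNNReal (σ p) • Measure.dirac False with hP
  have hind : iIndepFun (fun (i : ι) (E : Set ι) => i ∈ E)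
      (ProbabilityTheory.setBernoulli u p) := by
    have h := iIndepFun_infinitePi (P := P) (X := fun _ x => x) fun _ => measurable_id
    rw [iIndepFun_iff_measure_inter_preimage_eq_mul] at h ⊢
    intro S sets hs
    simp only [setBernoulli_apply']
    exact h S hs
  refine ⟨fun e => measurable_set_mem _, hind.precomp hf, fun e he => ?_⟩
  have hpi : {g : ι → Prop | g (f e)} = Set.pi (({f e} : Finset ι) : Set ι) fun _ => {True} := by
    ext g; simp
  have hpre : (fun g : ι → Prop => {i | g i}) ⁻¹' {E : Set ι | f e ∈ E} = {g | g (f e)} := rfl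
  rw [measureReal_def, setBernoulli_apply', hpre, hpi, Measure.infinitePi_pi P (by simp)]
  simp [hP, hu e he]

lemma measurableSet_simpleGraph {V : Type*} [Finite V] (S : Set (SimpleGraph V)) :
    MeasurableSet S := by
  rw [← Set.preimage_image_eq S SimpleGraph.edgeSet_injective]
  exact SimpleGraph.measurable_edgeSet (Set.toFinite _).measurableSet

/-- Measurability is checked for each `N`; there the core is a finite graph, so every property of it
is measurable. -/
lemma measurableSet_core (B : ∀ N, Set (SimpleGraph (Fin N))) :
    MeasurableSet {ω : PoiGraph | ω.core ∈ B ω.1} := by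
  refine MeasurableSpace.measurableSet_iInf.2 fun N => ?_
  have hm : Measurable fun H : SimpleGraph (Fin N ⊕ ℕ) => H.comap Sum.inl := by
    refine SimpleGraph.measurable_iff_adj.2 fun a b => ?_
    simp only [SimpleGraph.comap_adj]
    fun_prop
  exact hm (measurableSet_simpleGraph (B N))

lemma measurableSet_core_not_typical (n : ℕ) (b δ : ℝ) :
    MeasurableSet {ω : PoiGraph | ¬ (δ * n ≤ ω.1 ∧ Typical n b δ ω.core)} :=
  measurableSet_core fun N => {H | ¬ (δ * n ≤ N ∧ Typical n b δ H)}

lemma coe_edgeProb {c : ℝ} (hc : 0 ≤ c) {n : ℕ} (hn : 0 < n) (hcn : c ≤ n) :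
    (edgeProb c n : ℝ) = c / n := by
  have hn' : (0 : ℝ) < n := by exact_mod_cast hn
  rw [edgeProb, Set.projIcc_of_mem zero_le_one ⟨by positivity, (div_le_one hn').2 hcn⟩]

section Model

variable {c b δ η : ℝ} {n N : ℕ}

/-- The conditions under which `IndepEdges.measureReal_not_typical_le` applies. -/
structure Large (c η : ℝ) (n : ℕ) : Prop where
  pos : 0 < n
  le : c ≤ n
  two_le : 2 ≤ η * n
  sq_le : 2 * c ^ 2 ≤ η * n

lemma eventually_large (c : ℝ) (hη : 0 < η) : ∀ᶠ n : ℕ in atTop, Large c η n := by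
  have h : Tendsto (fun n : ℕ => η * (n : ℝ)) atTop atTop :=
    tendsto_natCast_atTop_atTop.const_mul_atTop hη
  filter_upwards [eventually_gt_atTop 0, tendsto_natCast_atTop_atTop.eventually_ge_atTop c,
    h.eventually_ge_atTop 2, h.eventually_ge_atTop (2 * c ^ 2)] with n h₁ h₂ h₃ h₄
  exact ⟨h₁, h₂, h₃, h₄⟩

lemma binomialRandom_not_typical_le (hc : 0 < c) (hgap : ExcessGap c b δ η) (hη₀ : 0 < η)
    (hη₁ : η ≤ 1) (hn : Large c η n) :
    (SimpleGraph.binomialRandom (Fin n) (edgeProb c n)) {H | ¬ Typical n b δ H} ≤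
      ENNReal.ofReal (atypicalBound η n) := by
  have hX := IndepEdges.setBernoulli (V := Fin n) Sym2.diagSetᶜ (edgeProb c n) id
    Function.injective_id (fun e he => he)
  rw [coe_edgeProb hc.le hn.pos hn.le] at hX
  have h := hX.measureReal_not_typical_le hc hgap hη₀ hη₁ hn.pos hn.le hn.two_le hn.sq_le
    (by simp only [sub_self, abs_zero]; positivity) (G := SimpleGraph.fromEdgeSet)
    (fun ω a b hab => by simp [hab])
  rw [SimpleGraph.binomialRandom_eq_map, Measure.map_apply SimpleGraph.measurable_fromEdgeSet
    (measurableSet_simpleGraph _)]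
  rw [← ofReal_measureReal]
  exact ENNReal.ofReal_le_ofReal h

lemma gPoiGiven_not_typical_le (hc : 0 < c) (hgap : ExcessGap c b δ η) (hη₀ : 0 < η)
    (hη₁ : η ≤ 1) (hn : Large c η n) (hN : |(N : ℝ) - n| ≤ η * n) (hδN : δ * n ≤ N) :
    gPoiGiven (edgeProb c n) N {ω | ¬ (δ * n ≤ ω.1 ∧ Typical n b δ ω.core)} ≤
      ENNReal.ofReal (atypicalBound η n) := by
  have hX := IndepEdges.setBernoulli (V := Fin N) (admissibleEdges N) (edgeProb c n)
    (Sym2.map Sum.inl) (Sym2.map.injective Sum.inl_injective) (fun e he => by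
      induction e using Sym2.ind with | _ x y
      exact ⟨by simpa using he, x, by simp⟩)
  rw [coe_edgeProb hc.le hn.pos hn.le] at hX
  have h := hX.measureReal_not_typical_le hc hgap hη₀ hη₁ hn.pos hn.le hn.two_le hn.sq_le hN
    (G := fun E => (SimpleGraph.fromEdgeSet E).comap Sum.inl)
    (fun ω a b hab => by simp [hab])
  rw [gPoiGiven, Measure.map_apply (measurable_gPoiGiven_aux N)
    (measurableSet_core_not_typical n b δ)]
  have h' : (fun E : Set (Sym2 (Fin N ⊕ ℕ)) => (⟨N, SimpleGraph.fromEdgeSet E⟩ : PoiGraph)) ⁻¹'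
      {ω : PoiGraph | ¬ (δ * n ≤ ω.1 ∧ Typical n b δ ω.core)} =
        {E | ¬ Typical n b δ ((SimpleGraph.fromEdgeSet E).comap (Sum.inl : Fin N → _))} := by
    ext E
    simp [hδN, PoiGraph.core]
  rw [h', ← ofReal_measureReal]
  exact ENNReal.ofReal_le_ofReal h

end Model

/-! ### Concentration of the Poisson law -/

lemma hasSum_exp_mul_poisson (r : ℝ≥0) (t : ℝ) :
    HasSum (fun n : ℕ => Real.exp (-r) * (r : ℝ) ^ n / n.factorial * Real.exp (t * n))
      (Real.exp (r * (Real.exp t - 1))) := by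
  have h := (NormedSpace.expSeries_div_hasSum_exp ((r : ℝ) * Real.exp t)).mul_left (Real.exp (-r))
  rw [← Real.exp_eq_exp_ℝ, ← Real.exp_add] at h
  convert! h using 1
  · ext n
    rw [mul_pow, ← Real.exp_nat_mul, mul_comm (n : ℝ) t]
    ring
  · congr 1; ring

lemma integrable_exp_poissonMeasure (r : ℝ≥0) (t : ℝ) :
    Integrable (fun n : ℕ => Real.exp (t * n)) (poissonMeasure r) := by
  rw [integrable_poissonMeasure_iff]
  simpa using (hasSum_exp_mul_poisson r t).summable

lemma mgf_poissonMeasure (r : ℝ≥0) (t : ℝ) :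
    mgf (fun n : ℕ => (n : ℝ)) (poissonMeasure r) t = Real.exp (r * (Real.exp t - 1)) := by
  rw [mgf, integral_poissonMeasure]
  exact (hasSum_exp_mul_poisson r t).tsum_eq

/-- Chernoff with `t = ± η / 2` and `exp t - 1 ≤ t + t²`: both exponents are at most `(-η² / 2 + η²
/ 4) n`. -/
lemma poissonMeasure_real_tail_le {η : ℝ} (hη₀ : 0 ≤ η) (hη₁ : η ≤ 1) (n : ℕ) :
    (poissonMeasure n).real {N : ℕ | ¬ |(N : ℝ) - n| ≤ η * n} ≤
      2 * Real.exp (-(η ^ 2 / 4 * n)) := by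
  have hexp : ∀ t : ℝ, |t| ≤ 1 → Real.exp t - 1 ≤ t + t ^ 2 := fun t ht => by
    linarith [(abs_le.1 (Real.abs_exp_sub_one_sub_id_le ht)).2]
  have hn : (0 : ℝ) ≤ n := Nat.cast_nonneg n
  have h₁ := measure_ge_le_exp_mul_mgf (μ := poissonMeasure n) (X := fun N : ℕ => (N : ℝ))
    (t := η / 2) ((1 + η) * n) (by positivity) (integrable_exp_poissonMeasure _ _)
  have h₂ := measure_le_le_exp_mul_mgf (μ := poissonMeasure n) (X := fun N : ℕ => (N : ℝ))
    (t := -(η / 2)) ((1 - η) * n) (by linarith) (integrable_exp_poissonMeasure _ _)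
  rw [mgf_poissonMeasure, ← Real.exp_add] at h₁ h₂
  have hsub : {N : ℕ | ¬ |(N : ℝ) - n| ≤ η * n} ⊆
      {N : ℕ | (1 + η) * n ≤ (N : ℝ)} ∪ {N : ℕ | (N : ℝ) ≤ (1 - η) * n} := by
    intro N hN
    have hN' : η * n < |(N : ℝ) - n| := not_le.1 hN
    rcases lt_abs.1 hN' with h | h
    · left; show (1 + η) * n ≤ (N : ℝ); linarith
    · right; show (N : ℝ) ≤ (1 - η) * n; linarith
  refine (measureReal_mono hsub (measure_ne_top _ _)).trans
    ((measureReal_union_le _ _).trans ?_)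
  rw [two_mul]
  refine add_le_add (h₁.trans (Real.exp_le_exp.2 ?_)) (h₂.trans (Real.exp_le_exp.2 ?_))
  · have := hexp (η / 2) (by rw [abs_of_nonneg (by positivity)]; linarith)
    push_cast
    nlinarith
  · have := hexp (-(η / 2)) (by rw [abs_neg, abs_of_nonneg (by positivity)]; linarith)
    push_cast
    nlinarith

lemma tendsto_poissonMeasure_tail {η : ℝ} (hη₀ : 0 < η) (hη₁ : η ≤ 1) :
    Tendsto (fun n : ℕ => poissonMeasure n {N : ℕ | ¬ |(N : ℝ) - n| ≤ η * n}) atTop (𝓝 0) := by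
  have h : Tendsto (fun n : ℕ => ENNReal.ofReal (2 * Real.exp (-(η ^ 2 / 4 * n)))) atTop
      (𝓝 0) := by
    rw [← ENNReal.ofReal_zero]
    refine ENNReal.tendsto_ofReal ?_
    have : Tendsto (fun n : ℕ => η ^ 2 / 4 * (n : ℝ)) atTop atTop :=
      tendsto_natCast_atTop_atTop.const_mul_atTop (by positivity)
    simpa using (Real.tendsto_exp_neg_atTop_nhds_zero.comp this).const_mul 2
  refine tendsto_of_tendsto_of_tendsto_of_le_of_le tendsto_const_nhds h (fun _ => bot_le)
    fun n => ?_
  dsimp only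
  rw [← ofReal_measureReal]
  exact ENNReal.ofReal_le_ofReal (poissonMeasure_real_tail_le hη₀.le hη₁ n)

/-! ### Typicality with high probability -/

lemma ExcessGap.mono {c b δ η η' : ℝ} (h : ExcessGap c b δ η) (hη : η' ≤ η) :
    ExcessGap c b δ η' :=
  ⟨fun y h₁ h₂ => by linarith [h.1 y h₁ h₂], fun y hy => by linarith [h.2 y hy]⟩

section Whp

variable {Ω : ℕ → Type*} [∀ n, MeasurableSpace (Ω n)]

/-- With high probability the random graphs `G n` are typical and have order at least `δ n`. -/
def WhpTypical (μ : ∀ n, Measure (Ω n)) {N : ∀ n, Ω n → ℕ}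
    (G : ∀ n (ω : Ω n), SimpleGraph (Fin (N n ω))) (b : ℝ) : Prop :=
  ∀ δ : ℝ, 0 < δ → δ ≤ 1 / 2 →
    Tendsto (fun n : ℕ => μ n {ω | ¬ (δ * n ≤ N n ω ∧ Typical n b δ (G n ω))}) atTop (𝓝 0)

namespace WhpTypical

variable {μ : ∀ n, Measure (Ω n)} {N : ∀ n, Ω n → ℕ}
  {G : ∀ n (ω : Ω n), SimpleGraph (Fin (N n ω))} {b : ℝ}

/-- Whatever holds for typical graphs of positive index fails with vanishing probability. -/
lemma tendsto_measure (h : WhpTypical μ G b) {δ : ℝ} (hδ₀ : 0 < δ) (hδ₁ : δ ≤ 1 / 2)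
    (A : ∀ n, Set (Ω n)) (hA : ∀ n, 0 < n → ∀ ω ∈ A n, δ * n ≤ N n ω →
      ¬ Typical n b δ (G n ω)) :
    Tendsto (fun n => μ n (A n)) atTop (𝓝 0) := by
  refine tendsto_of_tendsto_of_tendsto_of_le_of_le' tendsto_const_nhds (h δ hδ₀ hδ₁)
    (Eventually.of_forall fun _ => bot_le) ?_
  filter_upwards [eventually_gt_atTop 0] with n hn
  exact measure_mono fun ω hω h' => hA n hn ω hω h'.1 h'.2

/-- The cutoff `r` leaves room for `3 δ ≤ b`, on which the facts about giants depend. -/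
lemma littleOP (h : WhpTypical μ G b) {Y : ∀ n, Ω n → ℝ} {r : ℝ} (hr : 0 < r)
    (hY : ∀ δ, 0 < δ → δ ≤ r → ∀ n, 0 < n → ∀ ω, δ * n ≤ N n ω → Typical n b δ (G n ω) →
      |Y n ω| ≤ δ * n) : LittleOP μ Y := by
  intro ε hε
  have hδ : 0 < min (min (1 / 2) r) (ε / 2) := by positivity
  refine h.tendsto_measure hδ ((min_le_left _ _).trans (min_le_left _ _)) _
    fun n hn ω hω hN hT => ?_
  have hn' : (0 : ℝ) < n := by exact_mod_cast hn
  have h₁ := hY _ hδ ((min_le_left _ _).trans (min_le_right _ _)) n hn ω hN hT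
  have h₂ : ε ≤ |Y n ω / n| := hω
  rw [abs_div, abs_of_pos hn', le_div_iff₀ hn'] at h₂
  have h₃ := mul_le_mul_of_nonneg_right (min_le_right (min (1 / 2) r) (ε / 2)) hn'.le
  nlinarith

lemma allCompsLittleOP (h : WhpTypical μ G 0) : AllCompsLittleOP μ G := by
  refine h.littleOP one_pos fun δ hδ _ n _ ω _ hT => ?_
  rw [abs_of_nonneg (Nat.cast_nonneg _)]
  simpa using hT.largestComp_le (by simpa using hδ.le)

lemma uniqueGiant [∀ n, IsProbabilityMeasure (μ n)] (h : WhpTypical μ G b) (hb : 0 < b) :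
    UniqueGiant μ G b := by
  refine ⟨fun δ' hδ₀ hδ₁ => ?_, ?_, ?_⟩
  · set A : ∀ n, Set (Ω n) :=
      fun n => {ω | ∃! C : (G n ω).ConnectedComponent, δ' * n ≤ (compSize C : ℝ)}
    set δ := min (min (1 / 2) (b / 3)) (min δ' (b - δ')) with hδ
    have hδ_pos : 0 < δ := lt_min (by positivity) (lt_min hδ₀ (by linarith))
    have e₁ : δ ≤ 1 / 2 := (min_le_left _ _).trans (min_le_left _ _)
    have e₂ : δ ≤ b / 3 := (min_le_left _ _).trans (min_le_right _ _)
    have e₃ : δ ≤ δ' := (min_le_right _ _).trans (min_le_left _ _)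
    have e₄ : δ ≤ b - δ' := (min_le_right _ _).trans (min_le_right _ _)
    have hlim := h.tendsto_measure hδ_pos e₁ (fun n => (A n)ᶜ) fun n hn ω hω hN hT =>
      hω (hT.existsUnique_giant hδ_pos (by linarith) hn hN e₃ (by linarith))
    have hlim' : Tendsto (fun n => 1 - μ n (A n)ᶜ) atTop (𝓝 1) := by
      simpa using ENNReal.Tendsto.sub tendsto_const_nhds hlim (Or.inl ENNReal.one_ne_top)
    refine tendsto_of_tendsto_of_tendsto_of_le_of_le hlim' tendsto_const_nhds (fun n => ?_)
      fun n => prob_le_one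
    -- Subadditivity suffices, so `A n` need not be shown measurable.
    rw [tsub_le_iff_right]
    calc (1 : ℝ≥0∞) = μ n (A n ∪ (A n)ᶜ) := by simp
      _ ≤ _ := measure_union_le _ _
  · exact h.littleOP (r := b / 3) (by positivity) fun δ hδ hr n hn ω hN hT =>
      hT.abs_largestComp_sub_le hδ (by linarith) hn hN
  · refine h.littleOP (r := b / 3) (by positivity) fun δ hδ hr n hn ω hN hT => ?_
    rw [abs_of_nonneg (Nat.cast_nonneg _)]
    exact hT.secondComp_le hδ (by linarith)

end WhpTypical

end Whp

lemma whpTypical_binomialRandom {c b : ℝ} (hc : 0 < c)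
    (hgap : ∀ δ > 0, ∃ η > 0, ExcessGap c b δ η) :
    WhpTypical (fun n : ℕ => SimpleGraph.binomialRandom (Fin n) (edgeProb c n))
      (N := fun n _ => n) (fun _ H => H) b := by
  intro δ hδ₀ hδ₁
  obtain ⟨η₀, hη₀, hgap⟩ := hgap δ hδ₀
  have hη : 0 < min η₀ 1 := by positivity
  have hlim := ENNReal.tendsto_ofReal (tendsto_atypicalBound hη)
  rw [ENNReal.ofReal_zero] at hlim
  refine tendsto_of_tendsto_of_tendsto_of_le_of_le' tendsto_const_nhds hlim
    (Eventually.of_forall fun _ => bot_le) ?_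
  filter_upwards [eventually_large c hη] with n hn
  have hδn : δ * n ≤ n := by nlinarith [Nat.cast_nonneg (α := ℝ) n]
  simpa only [hδn, true_and] using binomialRandom_not_typical_le hc
    (hgap.mono (min_le_left _ _)) hη (min_le_right _ _) hn

lemma whpTypical_gPoi {c b : ℝ} (hc : 0 < c) (hgap : ∀ δ > 0, ∃ η > 0, ExcessGap c b δ η) :
    WhpTypical (fun n : ℕ => gPoi (n : ℝ≥0) (edgeProb c n)) (fun _ ω => PoiGraph.core ω) b := by
  intro δ hδ₀ hδ₁
  obtain ⟨η₀, hη₀, hgap⟩ := hgap δ hδ₀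
  -- With `η ≤ 1 / 2`, a core size within `η n` of `n` is at least `n / 2 ≥ δ n`.
  set η := min η₀ (1 / 2)
  have hη : 0 < η := by positivity
  have hη₁ : η ≤ 1 / 2 := min_le_right _ _
  have hlim := (tendsto_poissonMeasure_tail hη (by linarith)).add
    (ENNReal.tendsto_ofReal (tendsto_atypicalBound hη))
  rw [ENNReal.ofReal_zero, add_zero] at hlim
  refine tendsto_of_tendsto_of_tendsto_of_le_of_le' tendsto_const_nhds hlim
    (Eventually.of_forall fun _ => bot_le) ?_
  filter_upwards [eventually_large c hη] with n hn
  rw [gPoi, Measure.bind_apply (measurableSet_core_not_typical n b δ)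
    Measurable.of_discrete.aemeasurable]
  set T : Set ℕ := {N : ℕ | ¬ |(N : ℝ) - n| ≤ η * n}
  calc ∫⁻ N, gPoiGiven (edgeProb c n) N {ω | ¬ (δ * n ≤ ω.1 ∧ Typical n b δ ω.core)}
        ∂poissonMeasure n
      -- Bound by `1` on the Poisson tail and uniformly in `N` off it.
      ≤ ∫⁻ N, (T.indicator 1 N + ENNReal.ofReal (atypicalBound η n)) ∂poissonMeasure n := by
        refine lintegral_mono fun N => ?_
        by_cases hN : N ∈ T
        · rw [Set.indicator_of_mem hN]
          exact prob_le_one.trans le_self_add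
        · rw [Set.indicator_of_notMem hN, zero_add]
          have hN' : |(N : ℝ) - n| ≤ η * n := not_not.1 hN
          refine gPoiGiven_not_typical_le hc (hgap.mono (min_le_left _ _)) hη (by linarith) hn hN'
            ?_
          nlinarith [(abs_le.1 hN').1, Nat.cast_nonneg (α := ℝ) n]
    _ = _ := by
        rw [lintegral_add_right _ measurable_const, lintegral_indicator_one .of_discrete]
        simp

/-! ### The two regimes -/

theorem corollary1 (c : ℝ) (hc : 0 < c) :
    (c < 1 →
      AllCompsLittleOP (fun n : ℕ => gPoi (n : ℝ≥0) (edgeProb c n))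
        (fun _ ω => PoiGraph.core ω) ∧
      AllCompsLittleOP (fun n : ℕ => SimpleGraph.binomialRandom (Fin n) (edgeProb c n))
        (fun _ H => H)) ∧
    (1 < c →
      positiveRoots c = {giantFraction c} ∧
      UniqueGiant (fun n : ℕ => gPoi (n : ℝ≥0) (edgeProb c n))
        (fun _ ω => PoiGraph.core ω) (giantFraction c) ∧
      UniqueGiant (fun n : ℕ => SimpleGraph.binomialRandom (Fin n) (edgeProb c n))
        (fun _ H => H) (giantFraction c)) := by
  refine ⟨fun hc₁ => ?_, fun hc₁ => ⟨positiveRoots_eq hc₁, ?_⟩⟩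
  · have hgap : ∀ δ > 0, ∃ η > 0, ExcessGap c 0 δ η := fun δ hδ =>
      exists_excessGap_subcritical hc₁ hδ
    exact ⟨(whpTypical_gPoi hc hgap).allCompsLittleOP,
      (whpTypical_binomialRandom hc hgap).allCompsLittleOP⟩
  · have hgap : ∀ δ > 0, ∃ η > 0, ExcessGap c (giantFraction c) δ η := fun δ hδ =>
      exists_excessGap_supercritical hc₁ hδ
    have hb := (giantFraction_spec hc₁).1
    exact ⟨(whpTypical_gPoi hc hgap).uniqueGiant hb,
      (whpTypical_binomialRandom hc hgap).uniqueGiant hb⟩
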